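/- \textbf{Setting.} For real numbers $a<b$ let $M=S^1\times[a,b]$, $S^1=\mathbb{R}/2\pi\mathbb{Z}$, with coordinates $(x,y)$, carrying the Misner metric $g=dx\,dy-y\,dx^2$, where $dx\,dy=\tfrac12(dx\otimes dy+dy\otimes dx)$. Its null directions are spanned by $\partial_+=\partial_y$ and $\partial_-=-\partial_x-y\,\partial_y$. All functions are real, and $C^\infty(M)$ denotes functions smooth up to the boundary. Let $EL=\{\phi\in C^\infty(M): \partial_\mu(\sqrt{|g|}\,g^{\mu\nu}\partial_\nu\phi)=0\}$ be the space of solutions of the wave equation, and let $$EL^{\mathrm{glob}}=\{F+G:\ F,G\in C^\infty(M),\ \partial_-F=\partial_+G=0\}.$$ Choose a smooth vector field $n=n^x\partial_x+n^y\partial_y$ of $M$ along $\partial M$ that is everywhere transversal to $\partial M$ (i.e. $n^y\ne0$), and let $n^*$ be the covector field along $\partial M$ with $\langle n^*,n\rangle=1$ and $n^*|_{T\partial M}=0$. Put $\Gamma=g^{-1}(n^*,n^*)$, $u=g^{-1}(n^*,\cdot)-\Gamma n$ (a tangent field of $\partial M$), $\mu=\iota_n\mu_g$, where $\mu_g=\sqrt{|g|}\,dx\wedge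 dy$. On $\tilde\Phi=C^\infty(\partial M)\times C^\infty(\partial M)$ consider the presymplectic form $$\tilde\omega((f,f_n),(h,h_n))=\int_{\partial M}\mu\,(\Gamma f_n+u(f))\,h-\int_{\partial M}\mu\,(\Gamma h_n+u(h))\,f ,$$ with $\partial M$ oriented as the boundary of $M$ (outward normal first, $M$ oriented by $dx\wedge dy$). Let $\Phi=\tilde\Phi/\ker\tilde\omega$ with the induced symplectic form $\omega$, let $\pi:C^\infty(M)\to\Phi$ be $\phi\mapsto[(\phi|_{\partial M},\partial_n\phi|_{\partial M})]$, and put $L=\pi(EL)$ (the evolution relation), $L^{\mathrm{glob}}=\pi(EL^{\mathrm{glob}})$. For a subspace $V\subset\Phi$, $V^\perp$ is its $\omega$-orthogonal; $V$ is isotropic if $V\subset V^\perp$ and Lagrangian if $V=V^\perp$. \textbf{Statement.} (1) Let $[a,b]$ be $[-1,1]$, $[-1,0]$ or $[0,1]$ (the Misner cylinder and its two halves). Then $EL=EL^{\mathrm{glob}}$, and $EL$ is also equal to the space of $\phi\in C^\infty(M)$ such that $d\phi=\kappa+\lambda$ for some smooth closed 1-forms $\kappa,\lambda$ with $\iota_{\partial_-}\kappa=\iota_{\partial_+}\lambda=0$.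 For every choice of $n$: $L=L^{\mathrm{glob}}$; $L$ is the set of classes of those boundary data whose restriction to each of the two boundary circles is $(\phi,\phi_n)=(f,\,n^x\,\partial_xf)$, with one and the same $f\in C^\infty(S^1)$ on both circles; $L$ is isotropic; $\dim L^\perp/L=\infty$; in particular $L$ is not Lagrangian. (2) Let $[a,b]=[-1,1]$, $n=2\partial_y-\partial_x$ on the in-boundary $y=-1$ and $n=2\partial_y+\partial_x$ on the out-boundary $y=1$. Then $\ker\tilde\omega=0$, so $\Phi=\tilde\Phi=C^\infty(S^1)^4\ni(\phi^{\mathrm{in}},\phi^{\mathrm{in}}_n,\phi^{\mathrm{out}},\phi^{\mathrm{out}}_n)$; moreover $$\omega(\phi,\psi)=\oint_{S^1}dx\,\bigl(\phi^{\mathrm{in}}_n\psi^{\mathrm{in}}-\phi^{\mathrm{in}}\psi^{\mathrm{in}}_n+\phi^{\mathrm{out}}_n\psi^{\mathrm{out}}-\phi^{\mathrm{out}}\psi^{\mathrm{out}}_n\bigr),$$ $$L=\{(f,\,-\partial_xf,\,f,\,\partial_xf):\ f\in C^\infty(S^1)\},$$ $$L^\perp=\{\phi\in\Phi:\ \partial_x\phi^{\mathrm{in}}-\phi^{\mathrm{in}}_n-\partial_x\phi^{\mathrm{out}}-\phi^{\mathrm{out}}_n=0\}.$$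 -/

import Mathlib

open scoped ContDiff

noncomputable section

namespace WaveCylinder

/-! ### The circle `ℝ / 2πℤ` and the algebra of smooth functions on it -/

/-- The circle `ℝ / 2πℤ`. -/
abbrev S1 : Type := AddCircle (2 * Real.pi)

/-- The algebra `C^∞(S¹)`: real functions on the circle whose pull-back to `ℝ` is smooth. -/
def smoothCircle : Subalgebra ℝ (S1 → ℝ) where
  carrier := {f | ContDiff ℝ ∞ fun t : ℝ => f (t : S1)}
  mul_mem' {f g} hf hg := by
    simp only [Set.mem_ofPred_eq] at hf hg ⊢
    exact hf.mul hg
  add_mem' {f g} hf hg := by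
    simp only [Set.mem_ofPred_eq] at hf hg ⊢
    exact hf.add hg
  algebraMap_mem' c := (contDiff_const : ContDiff ℝ ∞ fun _ : ℝ => c)

/-- The derivative `∂ₓ f` of a function on the circle. -/
def circleDerivFun (f : S1 → ℝ) (θ : S1) : ℝ :=
  deriv (fun t : ℝ => f (θ + (t : S1))) 0

theorem circleDerivFun_coe (f : S1 → ℝ) (x : ℝ) :
    circleDerivFun f (x : S1) = deriv (fun t : ℝ => f (t : S1)) x := by
  have h := deriv_comp_const_add (fun t : ℝ => f (t : S1)) x 0
  simpa [circleDerivFun, AddCircle.coe_add] using h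

theorem smoothCircle_differentiable (f : smoothCircle) :
    Differentiable ℝ fun t : ℝ => f.1 (t : S1) :=
  ContDiff.differentiable (n := ∞) f.2 (by simp)

theorem circleDerivFun_mem (f : smoothCircle) : circleDerivFun f.1 ∈ smoothCircle := by
  change ContDiff ℝ ∞ fun t : ℝ => circleDerivFun f.1 (t : S1)
  simp only [circleDerivFun_coe]
  exact (contDiff_infty_iff_deriv.1 f.2).2

/-- The derivative `∂ₓ : C^∞(S¹) → C^∞(S¹)`. -/
def circleDeriv : smoothCircle →ₗ[ℝ] smoothCircle where
  toFun f := ⟨circleDerivFun f.1, circleDerivFun_mem f⟩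
  map_add' f g := by
    ext θ
    obtain ⟨x, rfl⟩ := QuotientAddGroup.mk_surjective θ
    change circleDerivFun (f.1 + g.1) (x : S1)
      = circleDerivFun f.1 (x : S1) + circleDerivFun g.1 (x : S1)
    simp only [circleDerivFun_coe]
    exact deriv_add (smoothCircle_differentiable f x) (smoothCircle_differentiable g x)
  map_smul' c f := by
    ext θ
    obtain ⟨x, rfl⟩ := QuotientAddGroup.mk_surjective θ
    change circleDerivFun (c • f.1) (x : S1) = c • circleDerivFun f.1 (x : S1)
    simp only [circleDerivFun_coe]
    exact deriv_const_smul c (smoothCircle_differentiable f x)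

/-- The integral `∮ f dx` over the circle, oriented by `dx`. -/
def circleInt : smoothCircle →ₗ[ℝ] ℝ where
  toFun f := ∫ x in (0 : ℝ)..(2 * Real.pi), f.1 (x : S1)
  map_add' f g := intervalIntegral.integral_add
    ((smoothCircle_differentiable f).continuous.intervalIntegrable _ _)
    ((smoothCircle_differentiable g).continuous.intervalIntegrable _ _)
  map_smul' c _ := intervalIntegral.integral_smul c _

/-- The reciprocal of a nowhere vanishing smooth function on the circle. -/
def circleInv (f : smoothCircle) (hf : ∀ θ, f.1 θ ≠ 0) : smoothCircle :=
  ⟨fun θ => (f.1 θ)⁻¹, by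
    have h : ContDiff ℝ ∞ fun t : ℝ => f.1 (t : S1) := f.2
    exact h.inv fun _ => hf _⟩

/-! ### Cylinders, smooth functions up to the boundary, vector fields and 1-forms -/

/-- A compact interval `[lo, hi]` with `lo < hi`, giving the cylinder `S¹ × [lo, hi]`. -/
structure Cylinder where
  lo : ℝ
  hi : ℝ
  lt : lo < hi

namespace Cylinder

variable (C : Cylinder)

/-- The points of the cylinder `S¹ × [lo, hi]`. -/
abbrev Point : Type := S1 × Set.Icc C.lo C.hi

/-- The closed strip `ℝ × [lo, hi]`, the universal cover of the cylinder. -/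
def strip : Set (ℝ × ℝ) := Set.univ ×ˢ Set.Icc C.lo C.hi

variable {C} in
/-- A function on the cylinder in the coordinates `(x, y)`. Only the values on the strip matter. -/
def lift (φ : C.Point → ℝ) (q : ℝ × ℝ) : ℝ :=
  φ ((q.1 : S1), Set.projIcc C.lo C.hi C.lt.le q.2)

/-- The space of fields `C^∞(M)`, `M = S¹ × [lo, hi]`: functions that are smooth up to the
boundary in the coordinates `(x, y)`. -/
def Fields : Subalgebra ℝ (C.Point → ℝ) where
  carrier := {φ | ContDiffOn ℝ ∞ (lift φ) C.strip}
  mul_mem' hf hg := ContDiffOn.mul hf hg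
  add_mem' hf hg := ContDiffOn.add hf hg
  algebraMap_mem' _ := contDiffOn_const

variable {C}

/-- The coordinate derivatives: `∂₀ = ∂ₓ` and `∂₁ = ∂_y` (one-sided at the boundary). -/
def partialFun (i : Fin 2) (φ : C.Point → ℝ) (p : C.Point) : ℝ :=
  if i = 0 then deriv (fun t : ℝ => φ (p.1 + (t : S1), p.2)) 0
  else derivWithin (fun s : ℝ => φ (p.1, Set.projIcc C.lo C.hi C.lt.le s))
    (Set.Icc C.lo C.hi) p.2

/-- The coordinate basis of `ℝ × ℝ`. -/
def basisVec (i : Fin 2) : ℝ × ℝ := if i = 0 then (1, 0) else (0, 1)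

theorem uniqueDiffOn_strip : UniqueDiffOn ℝ C.strip :=
  uniqueDiffOn_univ.prod (uniqueDiffOn_Icc C.lt)

theorem partialFun_eq (i : Fin 2) (φ : C.Fields) (x : ℝ) (y : Set.Icc C.lo C.hi) :
    partialFun i φ.1 ((x : S1), y)
      = fderivWithin ℝ (lift φ.1) C.strip (x, (y : ℝ)) (basisVec i) := by
  have hmem : ((x, (y : ℝ)) : ℝ × ℝ) ∈ C.strip := ⟨Set.mem_univ _, y.2⟩
  have hd : HasFDerivWithinAt (lift φ.1) (fderivWithin ℝ (lift φ.1) C.strip (x, (y : ℝ)))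
      C.strip (x, (y : ℝ)) :=
    ((ContDiffOn.differentiableOn (n := ∞) φ.2 (by simp)) _ hmem).hasFDerivWithinAt
  unfold partialFun basisVec
  split_ifs with hi
  · have hline : HasDerivWithinAt (fun t : ℝ => ((x + t, (y : ℝ)) : ℝ × ℝ)) (1, 0)
        Set.univ 0 := by
      have h1 : HasDerivAt (fun t : ℝ => x + t) 1 0 := (hasDerivAt_id (0 : ℝ)).const_add x
      exact (h1.prodMk (hasDerivAt_const (0 : ℝ) (y : ℝ))).hasDerivWithinAt
    have hd' : HasFDerivWithinAt (lift φ.1) (fderivWithin ℝ (lift φ.1) C.strip (x, (y : ℝ)))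
        C.strip ((fun t : ℝ => ((x + t, (y : ℝ)) : ℝ × ℝ)) 0) := by simpa using hd
    have hmaps : Set.MapsTo (fun t : ℝ => ((x + t, (y : ℝ)) : ℝ × ℝ)) Set.univ C.strip :=
      fun t _ => ⟨Set.mem_univ _, y.2⟩
    have h := hd'.comp_hasDerivWithinAt (0 : ℝ) hline hmaps
    have h' := h.hasDerivAt Filter.univ_mem
    rw [← h'.deriv]
    congr 1
    funext t
    simp [lift, Set.projIcc_of_mem C.lt.le y.2]
  · have hline : HasDerivWithinAt (fun s : ℝ => ((x, s) : ℝ × ℝ)) (0, 1)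
        (Set.Icc C.lo C.hi) (y : ℝ) :=
      ((hasDerivAt_const (y : ℝ) x).prodMk (hasDerivAt_id (y : ℝ))).hasDerivWithinAt
    have h := hd.comp_hasDerivWithinAt (y : ℝ) hline
      (fun s hs => ⟨Set.mem_univ _, hs⟩)
    rw [← h.derivWithin (uniqueDiffOn_Icc C.lt _ y.2)]
    rfl

theorem lift_partialFun (i : Fin 2) (φ : C.Fields) {q : ℝ × ℝ} (hq : q ∈ C.strip) :
    lift (partialFun i φ.1) q = fderivWithin ℝ (lift φ.1) C.strip q (basisVec i) := by
  have h := partialFun_eq i φ q.1 ⟨q.2, hq.2⟩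
  simpa [lift, Set.projIcc_of_mem C.lt.le hq.2] using h

theorem partialFun_mem (i : Fin 2) (φ : C.Fields) : partialFun i φ.1 ∈ C.Fields := by
  have h : ContDiffOn ℝ ∞ (fun q => fderivWithin ℝ (lift φ.1) C.strip q (basisVec i)) C.strip :=
    (ContDiffOn.fderivWithin (n := ∞) φ.2 uniqueDiffOn_strip (by simp)).clm_apply contDiffOn_const
  exact h.congr fun q hq => lift_partialFun i φ hq

theorem differentiableWithinAt_lift (φ : C.Fields) {q : ℝ × ℝ} (hq : q ∈ C.strip) :
    DifferentiableWithinAt ℝ (lift φ.1) C.strip q :=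
  (ContDiffOn.differentiableOn (n := ∞) φ.2 (by simp)) q hq

/-- The coordinate derivatives `∂₀ = ∂ₓ` and `∂₁ = ∂_y` as linear maps `C^∞(M) → C^∞(M)`. -/
def pd (i : Fin 2) : C.Fields →ₗ[ℝ] C.Fields where
  toFun φ := ⟨partialFun i φ.1, partialFun_mem i φ⟩
  map_add' φ ψ := by
    ext ⟨θ, y⟩
    obtain ⟨x, rfl⟩ := QuotientAddGroup.mk_surjective θ
    have hq : ((x, (y : ℝ)) : ℝ × ℝ) ∈ C.strip := ⟨Set.mem_univ _, y.2⟩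
    change partialFun i (φ + ψ).1 ((x : S1), y)
      = partialFun i φ.1 ((x : S1), y) + partialFun i ψ.1 ((x : S1), y)
    rw [partialFun_eq, partialFun_eq, partialFun_eq]
    have := fderivWithin_add (uniqueDiffOn_strip _ hq) (differentiableWithinAt_lift φ hq)
      (differentiableWithinAt_lift ψ hq)
    exact congrArg (fun L : ℝ × ℝ →L[ℝ] ℝ => L (basisVec i)) this
  map_smul' c φ := by
    ext ⟨θ, y⟩
    obtain ⟨x, rfl⟩ := QuotientAddGroup.mk_surjective θ
    have hq : ((x, (y : ℝ)) : ℝ × ℝ) ∈ C.strip := ⟨Set.mem_univ _, y.2⟩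
    change partialFun i (c • φ).1 ((x : S1), y) = c • partialFun i φ.1 ((x : S1), y)
    rw [partialFun_eq, partialFun_eq]
    have := fderivWithin_const_smul (uniqueDiffOn_strip _ hq)
      (differentiableWithinAt_lift φ hq) c
    exact congrArg (fun L : ℝ × ℝ →L[ℝ] ℝ => L (basisVec i)) this

variable (C) in
/-- Smooth vector fields `X = X⁰ ∂ₓ + X¹ ∂_y`. -/
abbrev VectorField : Type := Fin 2 → C.Fields

variable (C) in
/-- Smooth 1-forms `κ = κ₀ dx + κ₁ dy`. -/
abbrev OneForm : Type := Fin 2 → C.Fields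

/-- The exterior derivative `dφ` of a function. -/
def d (φ : C.Fields) : C.OneForm := fun i => pd i φ

/-- Closed 1-forms. -/
def OneForm.IsClosed (κ : C.OneForm) : Prop := pd 0 (κ 1) = pd 1 (κ 0)

/-- The contraction `ι_X κ`. -/
def contract (X : C.VectorField) (κ : C.OneForm) : C.Fields := ∑ i, X i * κ i

/-! ### Lorentzian metrics and the wave equation -/

variable (C) in
/-- A smooth Lorentzian metric on the cylinder, given by its coefficients `g_{ij}` in the
coordinates `(x, y)`; in dimension two, Lorentzian signature means negative determinant. -/
structure LorentzMetric where
  coeff : Matrix (Fin 2) (Fin 2) C.Fields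
  symm : coeff.IsSymm
  det_neg : ∀ p : C.Point, (coeff.map fun f => f.1 p).det < 0

namespace LorentzMetric

variable (g : C.LorentzMetric)

/-- The matrix `(g_{ij}(p))`. -/
def mat (p : C.Point) : Matrix (Fin 2) (Fin 2) ℝ := g.coeff.map fun f => f.1 p

theorem det_smooth : (fun p => (g.mat p).det) ∈ C.Fields := by
  have h : (fun p => (g.mat p).det) = g.coeff.det.1 := by
    funext p
    simp [mat, Matrix.det_fin_two]
  rw [h]
  exact g.coeff.det.2

theorem sqrt_smooth : (fun p => Real.sqrt |(g.mat p).det|) ∈ C.Fields := by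
  have h : (fun p => Real.sqrt |(g.mat p).det|) = fun p => Real.sqrt (-(g.mat p).det) := by
    funext p
    rw [abs_of_neg (show (g.mat p).det < 0 from g.det_neg p)]
  rw [h]
  exact ContDiffOn.sqrt (ContDiffOn.neg g.det_smooth) fun q _ => by
    have := g.det_neg ((q.1 : S1), Set.projIcc C.lo C.hi C.lt.le q.2)
    exact (neg_pos.2 this).ne'

theorem inv_smooth (i j : Fin 2) : (fun p => (g.mat p)⁻¹ i j) ∈ C.Fields := by
  have h : (fun p => (g.mat p)⁻¹ i j)
      = fun p => ((g.mat p).det)⁻¹ * (g.coeff.adjugate i j).1 p := by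
    funext p
    rw [Matrix.inv_def, Matrix.smul_apply, Ring.inverse_eq_inv', smul_eq_mul]
    congr 1
    rw [Matrix.adjugate_fin_two, Matrix.adjugate_fin_two]
    fin_cases i <;> fin_cases j <;> simp [mat]
  rw [h]
  exact ContDiffOn.mul (ContDiffOn.inv g.det_smooth fun q _ => by
    have := g.det_neg ((q.1 : S1), Set.projIcc C.lo C.hi C.lt.le q.2)
    exact this.ne) (g.coeff.adjugate i j).2

/-- The inner product `g(X, Y)` of vector fields. -/
def inner (X Y : C.VectorField) : C.Fields := ∑ i, ∑ j, g.coeff i j * (X i * Y j)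

/-- The density `√|det g|` of the metric volume form `μ_g = √|det g| dx ∧ dy`. -/
def vol : C.Fields := ⟨fun p => Real.sqrt |(g.mat p).det|, g.sqrt_smooth⟩

/-- The coefficients `g^{ij}` of the inverse metric. -/
def ginv (i j : Fin 2) : C.Fields := ⟨fun p => (g.mat p)⁻¹ i j, g.inv_smooth i j⟩

/-- The operator `φ ↦ ∂_μ (√|g| g^{μν} ∂_ν φ)`. -/
def waveOp : C.Fields →ₗ[ℝ] C.Fields :=
  ∑ i, ∑ j, pd i ∘ₗ LinearMap.mulLeft ℝ (g.vol * g.ginv i j) ∘ₗ pd j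

/-- The Euler-Lagrange space `EL`: smooth solutions of the wave equation `d * d φ = 0`. -/
def EL : Submodule ℝ C.Fields := LinearMap.ker g.waveOp

end LorentzMetric

/-! ### The boundary phase space -/

/-- The two boundary circles: `false` is the in-boundary `y = lo`, `true` is the
out-boundary `y = hi`. -/
abbrev Side : Type := Bool

variable (C) in
/-- The `y`-coordinate of a boundary circle. -/
def bdry : Side → Set.Icc C.lo C.hi
  | false => ⟨C.lo, Set.left_mem_Icc.2 C.lt.le⟩
  | true => ⟨C.hi, Set.right_mem_Icc.2 C.lt.le⟩

/-- The sign comparing `dx` with the boundary orientation (outward normal first) on a boundary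
circle, when the cylinder is oriented by `dx ∧ dy`. -/
def sign : Side → ℝ
  | false => 1
  | true => -1

/-- The restriction of a field to a boundary circle. -/
def res (e : Side) : C.Fields →ₗ[ℝ] smoothCircle where
  toFun φ := ⟨fun θ => φ.1 (θ, C.bdry e), by
    have h : ContDiff ℝ ∞ fun t : ℝ => ((t, (C.bdry e : ℝ)) : ℝ × ℝ) :=
      contDiff_id.prodMk contDiff_const
    have h2 := ContDiffOn.comp (g := lift φ.1) (t := C.strip) φ.2 h.contDiffOn
      (s := Set.univ) (fun t _ => ⟨Set.mem_univ _, (C.bdry e).2⟩)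
    have h3 := contDiffOn_univ.1 h2
    change ContDiff ℝ ∞ fun t : ℝ => φ.1 ((t : S1), C.bdry e)
    have h4 : (fun t : ℝ => φ.1 ((t : S1), C.bdry e))
        = lift φ.1 ∘ fun t : ℝ => ((t, (C.bdry e : ℝ)) : ℝ × ℝ) := by
      funext t
      simp [lift]
    rw [h4]
    exact h3⟩
  map_add' _ _ := rfl
  map_smul' _ _ := rfl

/-- A smooth vector field `n = n⁰ ∂ₓ + n¹ ∂_y` of the cylinder along its boundary that is
transversal to the boundary everywhere. -/
structure TransversalField where
  toFun : Side → Fin 2 → smoothCircle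
  transversal : ∀ e θ, (toFun e 1).1 θ ≠ 0

/-- The pre-phase space of the boundary, `(φ, φ_n) ∈ C^∞(∂M) × C^∞(∂M)`, listed by boundary
circle. -/
abbrev PrePhase : Type := Side → smoothCircle × smoothCircle

section Boundary

variable (n : TransversalField)

/-- The derivative `∂_n φ` along the boundary. -/
def normalDeriv (e : Side) (φ : C.Fields) : smoothCircle :=
  ∑ i, n.toFun e i * res e (pd i φ)

/-- The projection `φ ↦ (φ|_∂M, ∂_n φ|_∂M)` to the pre-phase space. -/
def prePi : C.Fields →ₗ[ℝ] PrePhase where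
  toFun φ e := (res e φ, normalDeriv n e φ)
  map_add' φ ψ := by
    funext e
    simp [normalDeriv, mul_add, Finset.sum_add_distrib]
  map_smul' c φ := by
    funext e
    simp [normalDeriv]

/-- The covector field `n*` along the boundary with `⟨n*, n⟩ = 1` and `⟨n*, ∂ₓ⟩ = 0`. -/
def conormal (e : Side) : Fin 2 → smoothCircle :=
  ![0, circleInv (n.toFun e 1) (n.transversal e)]

variable (g : C.LorentzMetric)

/-- The function `Γ = g⁻¹(n*, n*)` on the boundary. -/
def gam (e : Side) : smoothCircle :=
  ∑ i, ∑ j, res e (g.ginv i j) * (conormal n e i * conormal n e j)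

/-- The components of the vector field `u = g⁻¹(n*, •) - Γ n` along the boundary. -/
def uField (e : Side) (j : Fin 2) : smoothCircle :=
  ∑ i, res e (g.ginv i j) * conormal n e i - gam n g e * n.toFun e j

/-- The vector field `u` is tangent to the boundary. -/
theorem uField_tangent (e : Side) : uField n g e 1 = 0 := by
  have h : conormal n e 1 * n.toFun e 1 = 1 := by
    ext θ
    exact inv_mul_cancel₀ (n.transversal e θ)
  have h0 : conormal n e 0 = 0 := rfl
  simp only [uField, gam, Fin.sum_univ_two, h0]
  linear_combination (-(res e (g.ginv 1 1) * conormal n e 1)) * h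

/-- The action of the tangent vector field `u = u⁰ ∂ₓ` on functions on the boundary. -/
def uAct (e : Side) (f : smoothCircle) : smoothCircle := uField n g e 0 * circleDeriv f

/-- The coefficient of `dx` in the volume form `μ = ι_n μ_g = √|g| (n⁰ dy - n¹ dx)` restricted to
the boundary. -/
def muDensity (e : Side) : smoothCircle := -(res e g.vol * n.toFun e 1)

/-- The 1-form `α` on the pre-phase space as a bilinear map:
`(f, h) ↦ ∫_∂M μ (Γ f_n + u(f)) h`, with the induced orientation of the boundary. -/
def alphaForm : PrePhase →ₗ[ℝ] PrePhase →ₗ[ℝ] ℝ :=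
  LinearMap.mk₂ ℝ
    (fun v w => ∑ e, sign e *
      circleInt (muDensity n g e * (gam n g e * (v e).2 + uAct n g e (v e).1) * (w e).1))
    (fun v v' w => by
      rw [← Finset.sum_add_distrib]
      refine Finset.sum_congr rfl fun e _ => ?_
      rw [← mul_add, ← map_add]
      congr 2
      simp only [uAct, Pi.add_apply, Prod.snd_add, Prod.fst_add, map_add]
      ring)
    (fun c v w => by
      rw [Finset.smul_sum]
      refine Finset.sum_congr rfl fun e _ => ?_
      rw [← mul_smul_comm, ← map_smul]
      congr 2
      simp only [uAct, Pi.smul_apply, Prod.smul_snd, Prod.smul_fst, map_smul, mul_smul_comm,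
        ← smul_add, smul_mul_assoc])
    (fun v w w' => by
      simp only [Fintype.sum_bool, Pi.add_apply, Prod.fst_add, mul_add, map_add]
      ring)
    (fun c v w => by
      simp only [Fintype.sum_bool, Pi.smul_apply, Prod.smul_fst, mul_smul_comm, map_smul]
      simp only [smul_eq_mul]
      ring)

/-- The presymplectic form `δα` on the pre-phase space:
`(f, h) ↦ ∫ μ (Γ f_n + u(f)) h - ∫ μ (Γ h_n + u(h)) f`. -/
def preOmega : PrePhase →ₗ[ℝ] PrePhase →ₗ[ℝ] ℝ :=
  alphaForm n g - (alphaForm n g).flip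

theorem preOmega_isAlt : (preOmega n g).IsAlt := fun v => by simp [preOmega]

/-- The phase space `Φ_∂M`: the reduction of the pre-phase space by the kernel of the
presymplectic form. -/
abbrev Phase : Type := PrePhase ⧸ LinearMap.ker (preOmega n g)

/-- The symplectic form on the phase space. -/
def omega : Phase n g →ₗ[ℝ] Phase n g →ₗ[ℝ] ℝ :=
  (preOmega_isAlt n g).isRefl.liftQ₂ (preOmega n g) _ le_rfl

/-- The point of the phase space represented by boundary data. -/
def toPhase : PrePhase →ₗ[ℝ] Phase n g := Submodule.mkQ _

theorem omega_toPhase (v w : PrePhase) :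
    omega n g (toPhase n g v) (toPhase n g w) = preOmega n g v w := rfl

/-- The projection `π : C^∞(M) → Φ_∂M`. -/
def proj : C.Fields →ₗ[ℝ] Phase n g := toPhase n g ∘ₗ prePi n

/-- The evolution relation `L = π(EL)`. -/
def L : Submodule ℝ (Phase n g) := g.EL.map (proj n g)

/-- The symplectic orthogonal of a subspace of the phase space. -/
def orth (V : Submodule ℝ (Phase n g)) : Submodule ℝ (Phase n g) :=
  V.orthogonalBilin (omega n g)

/-- Isotropic subspaces: `V ⊆ V^⊥`. -/
def IsIsotropic (V : Submodule ℝ (Phase n g)) : Prop := V ≤ orth n g V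

/-- Lagrangian subspaces: `V = V^⊥`. -/
def IsLagrangian (V : Submodule ℝ (Phase n g)) : Prop := V = orth n g V

end Boundary

end Cylinder

/-! ### The Misner metric -/

open Cylinder

variable (C : Cylinder)

/-- The coordinate function `y`. -/
def yCoord : C.Fields :=
  ⟨fun p => (p.2 : ℝ), (contDiff_snd.contDiffOn (s := C.strip)).congr fun q hq => by
    simp [lift, Set.projIcc_of_mem C.lt.le hq.2]⟩

/-- The Misner metric `g = dx dy - y dx²`, where `dx dy = (dx ⊗ dy + dy ⊗ dx) / 2`. -/
def misner : C.LorentzMetric where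
  coeff := !![-yCoord C, algebraMap ℝ _ (1 / 2); algebraMap ℝ _ (1 / 2), 0]
  symm := by
    ext i j
    fin_cases i <;> fin_cases j <;> rfl
  det_neg p := by
    simp [Matrix.det_fin_two]

/-- The null vector field `∂₊ = ∂_y`. -/
def nullPlus : C.VectorField := ![0, 1]

/-- The null vector field `∂₋ = -∂ₓ - y ∂_y`. -/
def nullMinus : C.VectorField := ![-1, -yCoord C]

theorem nullPlus_null : (misner C).inner (nullPlus C) (nullPlus C) = 0 := by
  simp [LorentzMetric.inner, misner, nullPlus]

theorem nullMinus_null : (misner C).inner (nullMinus C) (nullMinus C) = 0 := by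
  have h : (algebraMap ℝ C.Fields 2⁻¹) + algebraMap ℝ C.Fields 2⁻¹ = 1 := by
    rw [← map_add]; norm_num
  simp [LorentzMetric.inner, misner, nullMinus]
  linear_combination yCoord C * h

/-- The space `EL^glob` of fields `F + G` with globally defined `F`, `G` such that
`∂₋ F = 0 = ∂₊ G`. -/
def ELglob : Set C.Fields :=
  {φ | ∃ F G : C.Fields, φ = F + G ∧
    contract (nullMinus C) (d F) = 0 ∧ contract (nullPlus C) (d G) = 0}

/-- The fields `φ` with `dφ = κ + λ` for closed 1-forms with `ι_{∂₋} κ = 0 = ι_{∂₊} λ`: the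
primitives `F`, `G` of `κ`, `λ` may be multivalued. -/
def ELmulti : Set C.Fields :=
  {φ | ∃ κ l : C.OneForm, κ.IsClosed ∧ l.IsClosed ∧ d φ = κ + l ∧
    contract (nullMinus C) κ = 0 ∧ contract (nullPlus C) l = 0}

/-- The Misner cylinder `S¹ × [-1, 1]`. -/
def fullCylinder : Cylinder := ⟨-1, 1, by norm_num⟩

/-- The half-cylinder `S¹ × [-1, 0]`. -/
def lowerHalf : Cylinder := ⟨-1, 0, by norm_num⟩

/-- The half-cylinder `S¹ × [0, 1]`. -/
def upperHalf : Cylinder := ⟨0, 1, by norm_num⟩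

/-- The transversal field `n = 2∂_y - ∂ₓ` on the in-boundary and `n = 2∂_y + ∂ₓ` on the
out-boundary. -/
def misnerNormal : TransversalField where
  toFun e := ![algebraMap ℝ _ (if e then 1 else -1), algebraMap ℝ _ 2]
  transversal e θ := by
    change (2 : ℝ) ≠ 0
    norm_num

end WaveCylinder

end

/-!
The wave equation of the Misner metric reads `∂_y (∂ₓφ + y ∂_yφ) = 0`, so `∂ₓφ + y ∂_yφ` is a
function of `x`, namely the derivative of the restriction of `φ` to the circle `y = 0`.
Subtracting that restriction from `φ` leaves a function which is constant along the flow of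
`∂ₓ + y ∂_y`. The flow lines spiral onto the circle `y = 0`, where the difference vanishes; hence
the solutions are exactly the functions of `x`.

In terms of the boundary values of `φ` and `∂_yφ`, which involve no transversal field, the
presymplectic form is `2 ∑ ± ∮ (Tψ · φ - y ∂_yφ · ψ) dx` with `Tφ = ∂ₓφ + y ∂_yφ`. Pairing with the
boundary values of the functions of `x` shows that `L^⊥` consists of the data with the same `Tφ` on
both circles. At least one boundary circle lies at `y ≠ 0`. The data with `φ = 0` and `y ∂_yφ = f'`
there, and `φ = f`, `∂_yφ = 0` on the other circle, lie in `L^⊥`, and they are in `L` only if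
`f' = 0`. Therefore `L^⊥ / L` is infinite dimensional.
-/

noncomputable section

namespace WaveCylinder

open Cylinder

theorem finiteDimensional_range_of_ker_le {K V W W' : Type*} [DivisionRing K] [AddCommGroup V]
    [Module K V] [AddCommGroup W] [Module K W] [AddCommGroup W'] [Module K W']
    [FiniteDimensional K W] {T : V →ₗ[K] W} {S : V →ₗ[K] W'}
    (h : LinearMap.ker T ≤ LinearMap.ker S) : FiniteDimensional K (LinearMap.range S) := by
  have : FiniteDimensional K (V ⧸ LinearMap.ker T) :=
    T.quotKerEquivRange.symm.finiteDimensional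
  rw [← Submodule.range_liftQ (LinearMap.ker T) S h]
  infer_instance

/-! ### Smooth functions on the circle -/

theorem smoothCircle_ext_coe {f h : smoothCircle} (H : ∀ x : ℝ, f.1 (x : S1) = h.1 (x : S1)) :
    f = h := by
  ext θ
  obtain ⟨x, rfl⟩ := QuotientAddGroup.mk_surjective θ
  exact H x

theorem smoothCircle_continuous (f : smoothCircle) : Continuous fun t : ℝ => f.1 (t : S1) :=
  (smoothCircle_differentiable f).continuous

theorem hasDerivAt_smoothCircle (f : smoothCircle) (x : ℝ) :
    HasDerivAt (fun t : ℝ => f.1 (t : S1)) ((circleDeriv f).1 (x : S1)) x := by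
  have h := (smoothCircle_differentiable f x).hasDerivAt
  rwa [← circleDerivFun_coe] at h

theorem circleDeriv_eq_of_hasDerivAt {f h : smoothCircle}
    (H : ∀ x : ℝ, HasDerivAt (fun t : ℝ => f.1 (t : S1)) (h.1 (x : S1)) x) : circleDeriv f = h :=
  smoothCircle_ext_coe fun x => (hasDerivAt_smoothCircle f x).unique (H x)

theorem circleDeriv_mul (f h : smoothCircle) :
    circleDeriv (f * h) = circleDeriv f * h + f * circleDeriv h :=
  circleDeriv_eq_of_hasDerivAt fun x =>
    (hasDerivAt_smoothCircle f x).mul (hasDerivAt_smoothCircle h x)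

theorem circleInt_circleDeriv (f : smoothCircle) : circleInt (circleDeriv f) = 0 := by
  change ∫ x in (0 : ℝ)..(2 * Real.pi), (circleDeriv f).1 (x : S1) = 0
  rw [intervalIntegral.integral_eq_sub_of_hasDerivAt (fun x _ => hasDerivAt_smoothCircle f x)
    ((smoothCircle_continuous (circleDeriv f)).intervalIntegrable _ _)]
  simp [AddCircle.coe_period]

theorem circleInt_mul_circleDeriv (f h : smoothCircle) :
    circleInt (f * circleDeriv h) = -circleInt (circleDeriv f * h) := by
  rw [eq_neg_iff_add_eq_zero, add_comm, ← map_add, ← circleDeriv_mul, circleInt_circleDeriv]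

theorem eq_zero_of_circleInt_mul_self {f : smoothCircle} (h : circleInt (f * f) = 0) : f = 0 := by
  have hpos : (0 : ℝ) < 2 * Real.pi := Real.two_pi_pos
  have hzero : ∀ x ∈ Set.Icc (0 : ℝ) (2 * Real.pi), f.1 (x : S1) = 0 := by
    intro x hx
    by_contra hne
    exact (intervalIntegral.integral_pos hpos (smoothCircle_continuous (f * f)).continuousOn
      (fun y _ => mul_self_nonneg (f.1 (y : S1))) ⟨x, hx, mul_self_pos.2 hne⟩).ne' h
  ext θ
  have : Fact ((0 : ℝ) < 2 * Real.pi) := ⟨hpos⟩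
  obtain ⟨x, hx, rfl⟩ := AddCircle.coe_image_Icc_eq (2 * Real.pi) 0 ▸ Set.mem_univ θ
  exact hzero x (by simpa only [zero_add] using hx)

theorem forall_circleInt_mul_eq_zero_iff {f : smoothCircle} :
    (∀ k, circleInt (f * k) = 0) ↔ f = 0 :=
  ⟨fun h => eq_zero_of_circleInt_mul_self (h f), by rintro rfl k; rw [zero_mul, map_zero]⟩

/-- The function `sin (k x)` on the circle. -/
def circleSin (k : ℕ) : smoothCircle :=
  ⟨fun θ => Real.Angle.sin (k • (θ : Real.Angle)), by
    have h : (fun t : ℝ => Real.Angle.sin (k • (t : Real.Angle))) = fun t => Real.sin (k * t) := by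
      funext t
      rw [← Real.Angle.coe_nsmul, Real.Angle.sin_coe, nsmul_eq_mul]
    change ContDiff ℝ ∞ fun t : ℝ => Real.Angle.sin (k • (t : Real.Angle))
    rw [h]
    exact Real.contDiff_sin.comp (contDiff_const.mul contDiff_id)⟩

/-- The function `cos (k x)` on the circle. -/
def circleCos (k : ℕ) : smoothCircle :=
  ⟨fun θ => Real.Angle.cos (k • (θ : Real.Angle)), by
    have h : (fun t : ℝ => Real.Angle.cos (k • (t : Real.Angle))) = fun t => Real.cos (k * t) := by
      funext t
      rw [← Real.Angle.coe_nsmul, Real.Angle.cos_coe, nsmul_eq_mul]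
    change ContDiff ℝ ∞ fun t : ℝ => Real.Angle.cos (k • (t : Real.Angle))
    rw [h]
    exact Real.contDiff_cos.comp (contDiff_const.mul contDiff_id)⟩

theorem circleSin_coe (k : ℕ) (x : ℝ) : (circleSin k).1 (x : S1) = Real.sin (k * x) := by
  change Real.Angle.sin (k • (x : Real.Angle)) = _
  rw [← Real.Angle.coe_nsmul, Real.Angle.sin_coe, nsmul_eq_mul]

theorem circleCos_coe (k : ℕ) (x : ℝ) : (circleCos k).1 (x : S1) = Real.cos (k * x) := by
  change Real.Angle.cos (k • (x : Real.Angle)) = _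
  rw [← Real.Angle.coe_nsmul, Real.Angle.cos_coe, nsmul_eq_mul]

theorem circleDeriv_circleSin (k : ℕ) : circleDeriv (circleSin k) = (k : ℝ) • circleCos k := by
  refine circleDeriv_eq_of_hasDerivAt fun x => ?_
  change HasDerivAt _ ((k : ℝ) * (circleCos k).1 (x : S1)) x
  simp only [circleSin_coe, circleCos_coe]
  simpa [mul_comm] using ((hasDerivAt_id x).const_mul (k : ℝ)).sin

theorem circleDeriv_circleCos (k : ℕ) : circleDeriv (circleCos k) = -(k : ℝ) • circleSin k := by
  refine circleDeriv_eq_of_hasDerivAt fun x => ?_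
  change HasDerivAt _ (-(k : ℝ) * (circleSin k).1 (x : S1)) x
  simp only [circleSin_coe, circleCos_coe]
  simpa [mul_comm] using ((hasDerivAt_id x).const_mul (k : ℝ)).cos

theorem circleCos_ne_zero (k : ℕ) : circleCos k ≠ 0 := by
  intro h
  have h0 := circleCos_coe k 0
  rw [h, mul_zero, Real.cos_zero] at h0
  exact zero_ne_one h0

theorem linearIndependent_circleCos : LinearIndependent ℝ circleCos := by
  refine Module.End.eigenvectors_linearIndependent' (circleDeriv ∘ₗ circleDeriv)
    (fun k : ℕ => -(k : ℝ) ^ 2) ?_ _ fun k => ⟨?_, circleCos_ne_zero k⟩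
  · intro i j hij
    exact_mod_cast (sq_eq_sq₀ i.cast_nonneg j.cast_nonneg).1 (neg_injective hij)
  · rw [Module.End.mem_eigenspace_iff, LinearMap.comp_apply, circleDeriv_circleCos, map_smul,
      circleDeriv_circleSin, smul_smul]
    congr 1
    ring

theorem not_finiteDimensional_range_circleDeriv :
    ¬ FiniteDimensional ℝ (LinearMap.range circleDeriv) := by
  intro hfin
  have hmem (k : ℕ) : circleCos (k + 1) ∈ LinearMap.range circleDeriv := by
    refine ⟨((k + 1 : ℕ) : ℝ)⁻¹ • circleSin (k + 1), ?_⟩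
    rw [map_smul, circleDeriv_circleSin, inv_smul_smul₀ (Nat.cast_ne_zero.2 k.succ_ne_zero)]
  have hli : LinearIndependent ℝ
      fun k : ℕ => (⟨circleCos (k + 1), hmem k⟩ : LinearMap.range circleDeriv) :=
    LinearIndependent.of_comp (LinearMap.range circleDeriv).subtype
      (linearIndependent_circleCos.comp _ (add_left_injective 1))
  exact hli.finite.false

namespace Cylinder

variable {C : Cylinder}

/-! ### Calculus of fields on a cylinder -/

theorem mem_strip (x : ℝ) (y : Set.Icc C.lo C.hi) : ((x, (y : ℝ)) : ℝ × ℝ) ∈ C.strip :=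
  ⟨Set.mem_univ _, y.2⟩

theorem lift_coe (φ : C.Point → ℝ) (x : ℝ) (y : Set.Icc C.lo C.hi) :
    lift φ (x, (y : ℝ)) = φ ((x : S1), y) := by
  simp [lift]

theorem Fields.ext_coe {φ ψ : C.Fields}
    (h : ∀ (x : ℝ) (y : Set.Icc C.lo C.hi), φ.1 ((x : S1), y) = ψ.1 ((x : S1), y)) : φ = ψ := by
  ext ⟨θ, y⟩
  obtain ⟨x, rfl⟩ := QuotientAddGroup.mk_surjective θ
  exact h x y

theorem strip_subset_closure_interior : C.strip ⊆ closure (interior C.strip) := by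
  rw [strip, interior_prod_eq, closure_prod_eq, interior_Icc, closure_Ioo C.lt.ne, interior_univ,
    closure_univ]

theorem pd_pd_apply (i j : Fin 2) (φ : C.Fields) (x : ℝ) (y : Set.Icc C.lo C.hi) :
    (pd i (pd j φ)).1 ((x : S1), y) =
      fderivWithin ℝ (fderivWithin ℝ (lift φ.1) C.strip) C.strip (x, (y : ℝ))
        (basisVec i) (basisVec j) := by
  have hmem := mem_strip x y
  have hdiff : DifferentiableWithinAt ℝ (fderivWithin ℝ (lift φ.1) C.strip) C.strip (x, (y : ℝ)) :=
    (ContDiffOn.fderivWithin (n := ∞) (m := ∞) φ.2 uniqueDiffOn_strip (by simp)).differentiableOn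
      (by simp) _ hmem
  change partialFun i (pd j φ).1 ((x : S1), y) = _
  rw [partialFun_eq, fderivWithin_congr (f₁ := lift (pd j φ).1)
    (fun q hq => lift_partialFun j φ hq) (lift_partialFun j φ hmem),
    fderivWithin_clm_apply (uniqueDiffOn_strip _ hmem) hdiff (differentiableWithinAt_const _)]
  simp

theorem pd_comm (i j : Fin 2) (φ : C.Fields) : pd i (pd j φ) = pd j (pd i φ) := by
  refine Fields.ext_coe fun x y => ?_
  have hmem := mem_strip x y
  have hsymm : IsSymmSndFDerivWithinAt ℝ (lift φ.1) C.strip (x, (y : ℝ)) :=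
    (ContDiffOn.contDiffWithinAt φ.2 hmem).isSymmSndFDerivWithinAt
      (by simp only [minSmoothness_of_isRCLikeNormedField]; exact WithTop.coe_le_coe.2 le_top)
      uniqueDiffOn_strip (strip_subset_closure_interior hmem) hmem
  rw [pd_pd_apply, pd_pd_apply, hsymm]

theorem hasDerivWithinAt_lift_comp (φ : C.Fields) {γ : ℝ → ℝ × ℝ} {γ' : ℝ × ℝ} {s : Set ℝ} {t : ℝ}
    (hγ : HasDerivWithinAt γ γ' s t) (hmaps : Set.MapsTo γ s C.strip) (ht : t ∈ s) :
    HasDerivWithinAt (fun r => lift φ.1 (γ r))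
      (γ'.1 * lift (pd 0 φ).1 (γ t) + γ'.2 * lift (pd 1 φ).1 (γ t)) s t := by
  have hderiv := (differentiableWithinAt_lift φ
    (hmaps ht)).hasFDerivWithinAt.comp_hasDerivWithinAt t hγ hmaps
  have hγ' : γ' = γ'.1 • basisVec 0 + γ'.2 • basisVec 1 := by
    simp [basisVec]
  rw [hγ', map_add, map_smul, map_smul, ← lift_partialFun 0 φ (hmaps ht),
    ← lift_partialFun 1 φ (hmaps ht)] at hderiv
  exact hderiv

theorem hasDerivWithinAt_lift_vertical (φ : C.Fields) (x : ℝ) {y : ℝ}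
    (hy : y ∈ Set.Icc C.lo C.hi) :
    HasDerivWithinAt (fun s : ℝ => lift φ.1 (x, s)) (lift (pd 1 φ).1 (x, y))
      (Set.Icc C.lo C.hi) y := by
  simpa using hasDerivWithinAt_lift_comp φ
    ((hasDerivWithinAt_const y _ x).prodMk (hasDerivWithinAt_id y _))
    (fun s hs => mem_strip x ⟨s, hs⟩) hy

/-- The restriction of a field to the circle at height `y`. -/
def slice (y : Set.Icc C.lo C.hi) : C.Fields →ₐ[ℝ] smoothCircle where
  toFun φ := ⟨fun θ => φ.1 (θ, y), by
    have hlift : (fun t : ℝ => φ.1 ((t : S1), y)) = lift φ.1 ∘ fun t : ℝ => (t, (y : ℝ)) :=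
      funext fun t => (lift_coe φ.1 t y).symm
    change ContDiff ℝ ∞ fun t : ℝ => φ.1 ((t : S1), y)
    rw [hlift, ← contDiffOn_univ]
    exact ContDiffOn.comp (t := C.strip) φ.2
      (contDiff_id.prodMk contDiff_const).contDiffOn fun t _ => mem_strip t y⟩
  map_one' := rfl
  map_mul' _ _ := rfl
  map_zero' := rfl
  map_add' _ _ := rfl
  commutes' _ := rfl

theorem res_eq_slice (e : Side) (φ : C.Fields) : res e φ = slice (C.bdry e) φ := rfl

theorem slice_pd_zero (y : Set.Icc C.lo C.hi) (φ : C.Fields) :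
    slice y (pd 0 φ) = circleDeriv (slice y φ) := by
  ext θ
  change partialFun 0 φ.1 (θ, y) = circleDerivFun (fun θ => φ.1 (θ, y)) θ
  simp [partialFun, circleDerivFun]

variable (C) in
/-- The pull-back of functions along the projection `S¹ × [lo, hi] → S¹`. -/
def pullback : smoothCircle →ₐ[ℝ] C.Fields where
  toFun f := ⟨fun p => f.1 p.1, by
    have hcomp : ContDiff ℝ ∞ fun q : ℝ × ℝ => f.1 (q.1 : S1) :=
      ContDiff.comp (g := fun t : ℝ => f.1 (t : S1)) f.2 contDiff_fst
    exact hcomp.contDiffOn⟩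
  map_one' := rfl
  map_mul' _ _ := rfl
  map_zero' := rfl
  map_add' _ _ := rfl
  commutes' _ := rfl

theorem pd_zero_pullback (f : smoothCircle) :
    pd 0 (pullback C f) = pullback C (circleDeriv f) := rfl

theorem pd_one_pullback (f : smoothCircle) : pd 1 (pullback C f) = 0 := by
  ext ⟨θ, y⟩
  change partialFun 1 (fun p : C.Point => f.1 p.1) (θ, y) = 0
  simp [partialFun]

theorem eq_pullback_of_pd_one_eq_zero {φ : C.Fields} (h : pd 1 φ = 0) (y : Set.Icc C.lo C.hi) :
    φ = pullback C (slice y φ) := by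
  have hconst (x : ℝ) (s : Set.Icc C.lo C.hi) : φ.1 ((x : S1), s) = lift φ.1 (x, C.lo) := by
    have hderiv {t : ℝ} (ht : t ∈ Set.Icc C.lo C.hi) := hasDerivWithinAt_lift_vertical φ x ht
    rw [← lift_coe φ.1]
    refine constant_of_derivWithin_zero (fun t ht => (hderiv ht).differentiableWithinAt)
      (fun t ht => ?_) s s.2
    rw [(hderiv (Set.Ico_subset_Icc_self ht)).derivWithin
      (uniqueDiffOn_Icc C.lt t (Set.Ico_subset_Icc_self ht)), h]
    rfl
  exact Fields.ext_coe fun x s => (hconst x s).trans (hconst x y).symm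

/-! ### Transport along `∂ₓ + y ∂_y` -/

theorem lift_add_nat_mul_period (φ : C.Point → ℝ) (x y : ℝ) (k : ℕ) :
    lift φ (x + k * -(2 * Real.pi), y) = lift φ (x, y) := by
  have hcoe : ((x + k * -(2 * Real.pi) : ℝ) : S1) = (x : S1) := by
    rw [← nsmul_eq_mul, AddCircle.coe_add, AddCircle.coe_nsmul, AddCircle.coe_neg,
      AddCircle.coe_period, neg_zero, nsmul_zero, add_zero]
  simp only [lift, hcoe]

theorem mul_exp_mem (h0 : (0 : ℝ) ∈ Set.Icc C.lo C.hi) (y : Set.Icc C.lo C.hi) {t : ℝ}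
    (ht : t ≤ 0) : (y : ℝ) * Real.exp t ∈ Set.Icc C.lo C.hi := by
  have hmem := (convex_Icc C.lo C.hi).smul_mem_of_zero_mem h0 y.2
    ⟨(Real.exp_pos t).le, Real.exp_le_one_iff.2 ht⟩
  rwa [smul_eq_mul, mul_comm] at hmem

theorem lift_flow_eq {F : C.Fields} (h : pd 0 F + yCoord C * pd 1 F = 0)
    (h0 : (0 : ℝ) ∈ Set.Icc C.lo C.hi) (x : ℝ) (y : Set.Icc C.lo C.hi) {t : ℝ} (ht : t ≤ 0) :
    lift F.1 (x + t, y * Real.exp t) = lift F.1 (x, y) := by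
  have hderiv {s : ℝ} (hs : s ∈ Set.Icc t 0) : HasDerivWithinAt
      (fun s : ℝ => lift F.1 (x + s, y * Real.exp s)) 0 (Set.Icc t 0) s := by
    have hcurve : HasDerivWithinAt (fun s : ℝ => (x + s, y * Real.exp s))
        (1, y * Real.exp s) (Set.Icc t 0) s :=
      (((hasDerivAt_id s).const_add x).prodMk
        ((Real.hasDerivAt_exp s).const_mul (y : ℝ))).hasDerivWithinAt
    have hmem : y * Real.exp s ∈ Set.Icc C.lo C.hi := mul_exp_mem h0 y (Set.mem_Icc.1 hs).2
    have hzero := congrFun (congrArg Subtype.val h) ((x + s : ℝ), ⟨_, hmem⟩)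
    change (pd 0 F).1 (((x + s : ℝ) : S1), ⟨_, hmem⟩)
      + y * Real.exp s * (pd 1 F).1 (((x + s : ℝ) : S1), ⟨_, hmem⟩) = 0 at hzero
    rw [← lift_coe (pd 0 F).1, ← lift_coe (pd 1 F).1] at hzero
    simpa only [one_mul, hzero] using hasDerivWithinAt_lift_comp F hcurve
      (fun r hr => mem_strip (x + r) ⟨_, mul_exp_mem h0 y (Set.mem_Icc.1 hr).2⟩) hs
  have hconst := constant_of_has_deriv_right_zero
    (fun s hs => (hderiv hs).continuousWithinAt)
    (fun s hs => (hderiv (Set.Ico_subset_Icc_self hs)).mono_of_mem_nhdsWithin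
      (Icc_mem_nhdsGE_of_mem hs)) 0 (Set.right_mem_Icc.2 ht)
  simpa using hconst.symm

/-- Flowing for time `-2πk` returns to the same `x` and multiplies `y` by `exp (-2πk)`, so the
circle `y = 0` is a limit of the orbit of `(x, y)`. -/
theorem eq_apply_zero_of_transport {F : C.Fields} (h : pd 0 F + yCoord C * pd 1 F = 0)
    (h0 : (0 : ℝ) ∈ Set.Icc C.lo C.hi) (x : ℝ) (y : Set.Icc C.lo C.hi) :
    F.1 ((x : S1), y) = F.1 ((x : S1), ⟨0, h0⟩) := by
  have hneg : -(2 * Real.pi) < 0 := neg_lt_zero.2 Real.two_pi_pos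
  have hle (k : ℕ) : (k : ℝ) * -(2 * Real.pi) ≤ 0 :=
    mul_nonpos_of_nonneg_of_nonpos k.cast_nonneg hneg.le
  have hlim : Filter.Tendsto (fun k : ℕ => (y : ℝ) * Real.exp (k * -(2 * Real.pi)))
      Filter.atTop (nhds 0) := by
    simpa only [mul_zero, Function.comp_apply] using (Real.tendsto_exp_atBot.comp
      (tendsto_natCast_atTop_atTop.atTop_mul_const_of_neg hneg)).const_mul (y : ℝ)
  have hcont := (hasDerivWithinAt_lift_vertical F x h0).continuousWithinAt.tendsto.comp
    (tendsto_nhdsWithin_iff.2 ⟨hlim, Filter.Eventually.of_forall fun k => mul_exp_mem h0 y (hle k)⟩)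
  rw [← lift_coe F.1, ← lift_coe F.1]
  refine tendsto_nhds_unique (tendsto_const_nhds.congr fun k => ?_) hcont
  rw [Function.comp_apply, ← lift_flow_eq h h0 x y (hle k), lift_add_nat_mul_period]

end Cylinder

variable {C : Cylinder}

/-! ### Solutions of the wave equation -/

theorem misner_mat (p : C.Point) : (misner C).mat p = !![-(p.2 : ℝ), 1 / 2; 1 / 2, 0] := by
  ext i j
  fin_cases i <;> fin_cases j <;> rfl

theorem misner_det (p : C.Point) : ((misner C).mat p).det = -(1 / 4) := by
  rw [misner_mat, Matrix.det_fin_two_of]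
  norm_num

theorem misner_vol : (misner C).vol = algebraMap ℝ C.Fields (1 / 2) := by
  ext p
  change Real.sqrt |((misner C).mat p).det| = 1 / 2
  rw [misner_det, show |(-(1 / 4) : ℝ)| = (1 / 2) ^ 2 by norm_num]
  exact Real.sqrt_sq (by norm_num)

theorem misner_mat_inv (p : C.Point) : ((misner C).mat p)⁻¹ = !![0, 2; 2, 4 * (p.2 : ℝ)] := by
  refine Matrix.inv_eq_right_inv ?_
  rw [misner_mat, Matrix.mul_fin_two, Matrix.one_fin_two]
  congr! 3 <;> ring_nf

theorem misner_vol_mul_ginv (i j : Fin 2) :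
    (misner C).vol * (misner C).ginv i j = !![0, 1; 1, 2 * yCoord C] i j := by
  rw [misner_vol]
  ext p
  change 1 / 2 * ((misner C).mat p)⁻¹ i j = (!![0, 1; 1, 2 * yCoord C] i j).1 p
  rw [misner_mat_inv]
  fin_cases i <;> fin_cases j
  · exact mul_zero _
  · exact one_div_mul_cancel two_ne_zero
  · exact one_div_mul_cancel two_ne_zero
  · change 1 / 2 * (4 * (p.2 : ℝ)) = 2 * p.2
    ring

theorem waveOp_misner (φ : C.Fields) :
    (misner C).waveOp φ = (2 : ℝ) • pd 1 (pd 0 φ + yCoord C * pd 1 φ) := by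
  have hpd : pd 1 (2 * yCoord C * pd 1 φ) = (2 : ℝ) • pd 1 (yCoord C * pd 1 φ) := by
    rw [← map_smul, two_mul, add_mul, two_smul]
  simp only [LorentzMetric.waveOp, Fin.sum_univ_two, LinearMap.add_apply, LinearMap.comp_apply,
    LinearMap.mulLeft_apply, misner_vol_mul_ginv, Matrix.of_apply, Matrix.cons_val',
    Matrix.cons_val_zero, Matrix.cons_val_one, Matrix.cons_val_fin_one, zero_mul, one_mul,
    map_zero, zero_add, pd_comm 0 1 φ, hpd, map_add]
  module

theorem mem_EL_misner_iff {φ : C.Fields} :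
    φ ∈ (misner C).EL ↔ pd 1 (pd 0 φ + yCoord C * pd 1 φ) = 0 := by
  rw [LorentzMetric.EL, LinearMap.mem_ker, waveOp_misner, smul_eq_zero_iff_right two_ne_zero]

theorem contract_nullMinus (κ : C.OneForm) :
    contract (nullMinus C) κ = -(κ 0 + yCoord C * κ 1) := by
  simp only [contract, nullMinus, Fin.sum_univ_two, Matrix.cons_val_zero, Matrix.cons_val_one]
  ring

theorem contract_nullPlus (κ : C.OneForm) : contract (nullPlus C) κ = κ 1 := by
  simp only [contract, nullPlus, Fin.sum_univ_two, Matrix.cons_val_zero, Matrix.cons_val_one]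
  ring

theorem ELglob_subset_ELmulti : ELglob C ⊆ ELmulti C := by
  rintro _ ⟨F, G, rfl, hF, hG⟩
  exact ⟨d F, d G, pd_comm 0 1 F, pd_comm 0 1 G, funext fun _ => map_add _ _ _, hF, hG⟩

theorem ELmulti_subset_EL : ELmulti C ⊆ ((misner C).EL : Set C.Fields) := by
  rintro φ ⟨κ, l, -, hl, hd, hκ, hl1⟩
  have hφ0 : pd 0 φ = κ 0 + l 0 := congrFun hd 0
  have hφ1 : pd 1 φ = κ 1 + l 1 := congrFun hd 1
  rw [contract_nullMinus, neg_eq_zero] at hκ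
  rw [contract_nullPlus] at hl1
  have htransport : pd 0 φ + yCoord C * pd 1 φ = l 0 := by
    rw [hφ0, hφ1, hl1]
    linear_combination hκ
  rw [OneForm.IsClosed, hl1, map_zero] at hl
  rw [SetLike.mem_coe, mem_EL_misner_iff, htransport, ← hl]

theorem pullback_mem_ELglob (f : smoothCircle) : pullback C f ∈ ELglob C := by
  refine ⟨0, pullback C f, (zero_add _).symm, ?_, ?_⟩
  · rw [contract_nullMinus]
    simp only [d, map_zero, mul_zero, add_zero, neg_zero]
  · rw [contract_nullPlus]
    exact pd_one_pullback f

theorem pullback_mem_EL (f : smoothCircle) : pullback C f ∈ (misner C).EL :=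
  ELmulti_subset_EL (ELglob_subset_ELmulti (pullback_mem_ELglob f))

theorem eq_pullback_of_mem_EL (h0 : (0 : ℝ) ∈ Set.Icc C.lo C.hi) {φ : C.Fields}
    (hφ : φ ∈ (misner C).EL) : φ = pullback C (slice ⟨0, h0⟩ φ) := by
  have hslice : slice ⟨0, h0⟩ (pd 0 φ + yCoord C * pd 1 φ) = circleDeriv (slice ⟨0, h0⟩ φ) := by
    have hy : slice ⟨0, h0⟩ (yCoord C) = 0 := rfl
    rw [map_add, map_mul, hy, zero_mul, add_zero, slice_pd_zero]
  have hpull := eq_pullback_of_pd_one_eq_zero (mem_EL_misner_iff.1 hφ) ⟨0, h0⟩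
  rw [hslice] at hpull
  have htransport : pd 0 (φ - pullback C (slice ⟨0, h0⟩ φ))
      + yCoord C * pd 1 (φ - pullback C (slice ⟨0, h0⟩ φ)) = 0 := by
    rw [map_sub, map_sub, pd_zero_pullback, pd_one_pullback]
    linear_combination hpull
  refine Fields.ext_coe fun x y => sub_eq_zero.1 ?_
  exact (eq_apply_zero_of_transport htransport h0 x y).trans (sub_self _)

theorem EL_misner_eq_range (h0 : (0 : ℝ) ∈ Set.Icc C.lo C.hi) :
    (misner C).EL = LinearMap.range (pullback C).toLinearMap :=
  le_antisymm (fun _ hφ => ⟨_, (eq_pullback_of_mem_EL h0 hφ).symm⟩)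
    (LinearMap.range_le_iff_comap.2 (eq_top_iff.2 fun f _ => pullback_mem_EL f))

theorem EL_eq_ELglob (h0 : (0 : ℝ) ∈ Set.Icc C.lo C.hi) :
    ((misner C).EL : Set C.Fields) = ELglob C := by
  refine Set.Subset.antisymm (fun φ hφ => ?_) (ELglob_subset_ELmulti.trans ELmulti_subset_EL)
  rw [eq_pullback_of_mem_EL h0 hφ]
  exact pullback_mem_ELglob _

theorem EL_eq_ELmulti (h0 : (0 : ℝ) ∈ Set.Icc C.lo C.hi) :
    ((misner C).EL : Set C.Fields) = ELmulti C :=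
  ((EL_eq_ELglob h0).trans_subset ELglob_subset_ELmulti).antisymm ELmulti_subset_EL

/-! ### The presymplectic form in terms of boundary jets -/

section BoundaryJet

/-- Boundary values `(φ, ∂_y φ)` on the two boundary circles. Unlike elements of `PrePhase` they do
not depend on a transversal field. -/
abbrev BoundaryJet : Type := Side → smoothCircle × smoothCircle

variable (n : TransversalField)

theorem conormal_one_mul (e : Side) : conormal n e 1 * n.toFun e 1 = 1 := by
  ext θ
  exact inv_mul_cancel₀ (n.transversal e θ)

/-- The change of coordinates `(φ, ∂_y φ) ↦ (φ, n^x ∂ₓφ + n^y ∂_yφ) = (φ, ∂_n φ)` on boundary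
data. -/
def ofJet : BoundaryJet ≃ₗ[ℝ] PrePhase where
  toFun j e := ((j e).1, n.toFun e 0 * circleDeriv (j e).1 + n.toFun e 1 * (j e).2)
  invFun v e := ((v e).1, conormal n e 1 * ((v e).2 - n.toFun e 0 * circleDeriv (v e).1))
  map_add' j k := by
    funext e
    refine Prod.ext rfl ?_
    simp only [Pi.add_apply, Prod.fst_add, Prod.snd_add, map_add]
    ring
  map_smul' c j := by
    funext e
    refine Prod.ext rfl ?_
    simp only [Pi.smul_apply, Prod.smul_fst, Prod.smul_snd, map_smul, mul_smul_comm, smul_add,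
      RingHom.id_apply]
  left_inv j := by
    funext e
    refine Prod.ext rfl ?_
    linear_combination (j e).2 * conormal_one_mul n e
  right_inv v := by
    funext e
    refine Prod.ext rfl ?_
    linear_combination ((v e).2 - n.toFun e 0 * circleDeriv (v e).1) * conormal_one_mul n e

theorem ofJet_apply (j : BoundaryJet) (e : Side) : ofJet n j e =
    ((j e).1, n.toFun e 0 * circleDeriv (j e).1 + n.toFun e 1 * (j e).2) := rfl

theorem prePi_eq_ofJet (φ : C.Fields) :
    prePi n φ = ofJet n fun e => (res e φ, res e (pd 1 φ)) := by
  funext e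
  refine Prod.ext rfl ?_
  change ∑ i, n.toFun e i * res e (pd i φ) = _
  rw [Fin.sum_univ_two, res_eq_slice e (pd 0 φ), slice_pd_zero]
  rfl

/-- The boundary value of the density `√|g| g^{yν} ∂_ν φ`, as a function of `(φ, ∂_y φ)`. -/
def flux (g : C.LorentzMetric) (e : Side) : smoothCircle × smoothCircle →ₗ[ℝ] smoothCircle :=
  (LinearMap.mulLeft ℝ (res e (g.vol * g.ginv 1 0)) ∘ₗ circleDeriv).coprod
    (LinearMap.mulLeft ℝ (res e (g.vol * g.ginv 1 1)))

theorem flux_apply (g : C.LorentzMetric) (e : Side) (x : smoothCircle × smoothCircle) :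
    flux g e x =
      res e (g.vol * g.ginv 1 0) * circleDeriv x.1 + res e (g.vol * g.ginv 1 1) * x.2 := rfl

theorem muDensity_mul_ofJet (g : C.LorentzMetric) (j : BoundaryJet) (e : Side) :
    muDensity n g e * (gam n g e * (ofJet n j e).2 + uAct n g e (ofJet n j e).1) =
      -flux g e (j e) := by
  have h0 : conormal n e 0 = 0 := rfl
  simp only [flux_apply, ofJet_apply, muDensity, gam, uAct, uField, Fin.sum_univ_two, h0,
    res_eq_slice, map_mul]
  linear_combination -(slice (C.bdry e) g.vol * slice (C.bdry e) (g.ginv 1 0) *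
      circleDeriv (j e).1 + slice (C.bdry e) g.vol * slice (C.bdry e) (g.ginv 1 1) * (j e).2 *
      (conormal n e 1 * n.toFun e 1 + 1)) * conormal_one_mul n e

theorem preOmega_ofJet (g : C.LorentzMetric) (j k : BoundaryJet) :
    preOmega n g (ofJet n j) (ofJet n k) =
      ∑ e, sign e * circleInt (flux g e (k e) * (j e).1 - flux g e (j e) * (k e).1) := by
  change (∑ e, sign e * circleInt (muDensity n g e * (gam n g e * (ofJet n j e).2
      + uAct n g e (ofJet n j e).1) * (k e).1))
    - (∑ e, sign e * circleInt (muDensity n g e * (gam n g e * (ofJet n k e).2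
      + uAct n g e (ofJet n k e).1) * (j e).1)) = _
  rw [← Finset.sum_sub_distrib]
  refine Finset.sum_congr rfl fun e _ => ?_
  rw [← mul_sub, ← map_sub, muDensity_mul_ofJet, muDensity_mul_ofJet]
  congr 2
  ring

end BoundaryJet

/-! ### The evolution relation of the Misner metric -/

section EvolutionRelation

variable (C) in
/-- The boundary value `∂ₓφ + y ∂_yφ` of `-∂₋φ`, as a function of `(φ, ∂_y φ)`. -/
def transport (e : Side) : smoothCircle × smoothCircle →ₗ[ℝ] smoothCircle :=
  circleDeriv.coprod ((C.bdry e : ℝ) • LinearMap.id)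

theorem transport_apply (e : Side) (x : smoothCircle × smoothCircle) :
    transport C e x = circleDeriv x.1 + (C.bdry e : ℝ) • x.2 := rfl

theorem flux_misner (e : Side) (x : smoothCircle × smoothCircle) :
    flux (misner C) e x = circleDeriv x.1 + (2 * (C.bdry e : ℝ)) • x.2 := by
  rw [flux_apply, misner_vol_mul_ginv, misner_vol_mul_ginv, Algebra.smul_def]
  exact congrArg₂ _ (one_mul _) rfl

variable (n : TransversalField)

theorem preOmega_misner (j k : BoundaryJet) :
    preOmega n (misner C) (ofJet n j) (ofJet n k) = 2 * ∑ e, sign e * circleInt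
      (transport C e (k e) * (j e).1 - (C.bdry e : ℝ) • ((j e).2 * (k e).1)) := by
  rw [preOmega_ofJet, Finset.mul_sum]
  refine Finset.sum_congr rfl fun e _ => ?_
  have hparts := circleInt_mul_circleDeriv (j e).1 (k e).1
  simp only [flux_misner, transport_apply, add_mul, smul_mul_assoc, map_sub, map_add, map_smul,
    smul_eq_mul, mul_comm (circleDeriv (k e).1), hparts]
  ring

theorem preOmega_misner_single (e : Side) (x : smoothCircle × smoothCircle) (k : BoundaryJet) :
    preOmega n (misner C) (ofJet n (Pi.single e x)) (ofJet n k) = 2 * (sign e * circleInt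
      (transport C e (k e) * x.1 - (C.bdry e : ℝ) • (x.2 * (k e).1))) := by
  rw [preOmega_misner, Finset.sum_eq_single_of_mem e (Finset.mem_univ e), Pi.single_eq_same]
  intro e' _ hne
  rw [Pi.single_eq_of_ne hne, Prod.fst_zero, Prod.snd_zero, mul_zero, zero_mul, smul_zero, sub_zero,
    map_zero, mul_zero]

theorem sign_ne_zero (e : Side) : sign e ≠ 0 := by
  cases e <;> simp [sign]

theorem ofJet_mem_ker_preOmega_misner_iff {j : BoundaryJet} :
    ofJet n j ∈ LinearMap.ker (preOmega n (misner C)) ↔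
      ∀ e, transport C e (j e) = 0 ∧ (C.bdry e : ℝ) • (j e).1 = 0 := by
  rw [← (preOmega_isAlt n (misner C)).isRefl.ker_flip]
  refine ⟨fun hj e => ?_, fun hj => ?_⟩
  · have hpair (x : smoothCircle × smoothCircle) : circleInt
        (transport C e (j e) * x.1 - (C.bdry e : ℝ) • (x.2 * (j e).1)) = 0 := by
      have h : preOmega n (misner C) (ofJet n (Pi.single e x)) (ofJet n j) = 0 :=
        LinearMap.congr_fun (LinearMap.mem_ker.1 hj) _
      rw [preOmega_misner_single] at h
      simpa [sign_ne_zero] using h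
    refine ⟨forall_circleInt_mul_eq_zero_iff.1 fun k => ?_,
      forall_circleInt_mul_eq_zero_iff.1 fun k => ?_⟩
    · simpa using hpair (k, 0)
    · simpa [mul_comm] using hpair (0, k)
  · refine LinearMap.mem_ker.2 (LinearMap.ext fun v => ?_)
    obtain ⟨k, rfl⟩ := (ofJet n).surjective v
    rw [LinearMap.flip_apply, preOmega_misner]
    simp [hj, ← mul_smul_comm]

/-- The boundary values of the fields `(x, y) ↦ f x`. -/
def pullbackJet : smoothCircle →ₗ[ℝ] BoundaryJet := LinearMap.pi fun _ => LinearMap.inl ℝ _ _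

theorem prePi_pullback (f : smoothCircle) : prePi n (pullback C f) = ofJet n (pullbackJet f) := by
  rw [prePi_eq_ofJet]
  simp only [pd_one_pullback, map_zero]
  rfl

theorem ofJet_pullbackJet (f : smoothCircle) :
    ofJet n (pullbackJet f) = fun e => (f, n.toFun e 0 * circleDeriv f) := by
  funext e
  simp [ofJet_apply, pullbackJet]

theorem mem_L_misner_iff (h0 : (0 : ℝ) ∈ Set.Icc C.lo C.hi) {v : Phase n (misner C)} :
    v ∈ L n (misner C) ↔ ∃ f, v = toPhase n (misner C) (ofJet n (pullbackJet f)) := by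
  rw [L, EL_misner_eq_range h0, ← LinearMap.range_comp, LinearMap.mem_range]
  simp only [LinearMap.comp_apply, proj, AlgHom.toLinearMap_apply, prePi_pullback, eq_comm]

theorem preOmega_pullbackJet (f : smoothCircle) (j : BoundaryJet) :
    preOmega n (misner C) (ofJet n (pullbackJet f)) (ofJet n j) =
      2 * circleInt ((transport C false (j false) - transport C true (j true)) * f) := by
  have hjet (e : Side) : pullbackJet f e = (f, 0) := rfl
  simp only [preOmega_misner, hjet, zero_mul, smul_zero, sub_zero, Fintype.sum_bool, sign, sub_mul,
    map_sub]
  ring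

theorem toPhase_ofJet_mem_orth_L_iff (h0 : (0 : ℝ) ∈ Set.Icc C.lo C.hi) (j : BoundaryJet) :
    toPhase n (misner C) (ofJet n j) ∈ orth n (misner C) (L n (misner C)) ↔
      transport C false (j false) = transport C true (j true) := by
  rw [orth, Submodule.mem_orthogonalBilin_iff, ← sub_eq_zero, ← forall_circleInt_mul_eq_zero_iff]
  simp only [mem_L_misner_iff n h0, forall_exists_index, forall_eq_apply_imp_iff,
    omega_toPhase, preOmega_pullbackJet, mul_eq_zero, two_ne_zero, false_or]

theorem isIsotropic_L (h0 : (0 : ℝ) ∈ Set.Icc C.lo C.hi) :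
    IsIsotropic n (misner C) (L n (misner C)) := by
  intro v hv
  obtain ⟨f, rfl⟩ := (mem_L_misner_iff n h0).1 hv
  rw [toPhase_ofJet_mem_orth_L_iff n h0]
  simp [transport_apply, pullbackJet]

variable (C) in
/-- Data in `L^⊥` which agree with those of the field `(x, y) ↦ f x` on the boundary circle other
than `e`, while `φ = 0` on `e`. -/
def oneSidedJet (e : Side) : smoothCircle →ₗ[ℝ] BoundaryJet :=
  LinearMap.single ℝ _ (!e) ∘ₗ LinearMap.inl ℝ _ _ +
    LinearMap.single ℝ _ e ∘ₗ LinearMap.inr ℝ _ _ ∘ₗ ((C.bdry e : ℝ)⁻¹ • circleDeriv)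

theorem oneSidedJet_self (e : Side) (f : smoothCircle) :
    oneSidedJet C e f e = (0, (C.bdry e : ℝ)⁻¹ • circleDeriv f) := by
  simp [oneSidedJet]

theorem oneSidedJet_not (e : Side) (f : smoothCircle) : oneSidedJet C e f (!e) = (f, 0) := by
  simp [oneSidedJet]

theorem transport_oneSidedJet {e : Side} (he : (C.bdry e : ℝ) ≠ 0) (f : smoothCircle) (e' : Side) :
    transport C e' (oneSidedJet C e f e') = circleDeriv f := by
  rw [transport_apply]
  rcases eq_or_ne e' e with rfl | hne
  · rw [oneSidedJet_self, map_zero, zero_add, smul_inv_smul₀ he]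
  · rw [Bool.eq_not.2 hne, oneSidedJet_not, smul_zero, add_zero]

theorem toPhase_oneSidedJet_mem_orth_L (h0 : (0 : ℝ) ∈ Set.Icc C.lo C.hi) {e : Side}
    (he : (C.bdry e : ℝ) ≠ 0) (f : smoothCircle) :
    toPhase n (misner C) (ofJet n (oneSidedJet C e f)) ∈ orth n (misner C) (L n (misner C)) := by
  rw [toPhase_ofJet_mem_orth_L_iff n h0, transport_oneSidedJet he, transport_oneSidedJet he]

theorem circleDeriv_eq_zero_of_toPhase_oneSidedJet_mem_L (h0 : (0 : ℝ) ∈ Set.Icc C.lo C.hi)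
    {e : Side} (he : (C.bdry e : ℝ) ≠ 0) {f : smoothCircle}
    (hf : toPhase n (misner C) (ofJet n (oneSidedJet C e f)) ∈ L n (misner C)) :
    circleDeriv f = 0 := by
  obtain ⟨k, hk⟩ := (mem_L_misner_iff n h0).1 hf
  have hker : ofJet n (oneSidedJet C e f - pullbackJet k) ∈
      LinearMap.ker (preOmega n (misner C)) := by
    rw [map_sub]
    exact (Submodule.Quotient.eq _).1 hk
  rw [ofJet_mem_ker_preOmega_misner_iff] at hker
  have hk0 : k = 0 := by
    simpa [oneSidedJet_self, pullbackJet, he] using (hker e).2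
  simpa [hk0, transport_oneSidedJet he] using (hker e).1

variable (C) in
theorem exists_bdry_ne_zero : ∃ e, (C.bdry e : ℝ) ≠ 0 := by
  by_contra! h
  exact C.lt.ne ((h false).trans (h true).symm)

theorem not_finiteDimensional_orth_quotient_L (h0 : (0 : ℝ) ∈ Set.Icc C.lo C.hi) :
    ¬ FiniteDimensional ℝ
      (orth n (misner C) (L n (misner C)) ⧸
        (L n (misner C)).submoduleOf (orth n (misner C) (L n (misner C)))) := by
  intro hfin
  obtain ⟨e, he⟩ := exists_bdry_ne_zero C
  let oneSided : smoothCircle →ₗ[ℝ] orth n (misner C) (L n (misner C)) :=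
    (toPhase n (misner C) ∘ₗ (ofJet n).toLinearMap ∘ₗ oneSidedJet C e).codRestrict _
      (toPhase_oneSidedJet_mem_orth_L n h0 he)
  refine not_finiteDimensional_range_circleDeriv (finiteDimensional_range_of_ker_le
    (T := Submodule.mkQ ((L n (misner C)).submoduleOf _) ∘ₗ oneSided) fun f hf => ?_)
  rw [LinearMap.mem_ker, LinearMap.comp_apply, Submodule.mkQ_apply,
    Submodule.Quotient.mk_eq_zero] at hf
  exact circleDeriv_eq_zero_of_toPhase_oneSidedJet_mem_L n h0 he hf

theorem not_isLagrangian_L (h0 : (0 : ℝ) ∈ Set.Icc C.lo C.hi) :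
    ¬ IsLagrangian n (misner C) (L n (misner C)) := by
  intro hL
  have htop : (L n (misner C)).submoduleOf (orth n (misner C) (L n (misner C))) = ⊤ :=
    Submodule.submoduleOf_eq_top.2 hL.ge
  have := Submodule.Quotient.subsingleton_iff.2 htop
  exact not_finiteDimensional_orth_quotient_L n h0 Module.Finite.of_finite

end EvolutionRelation

/-! ### Transversal fields orthogonal to the boundary -/

theorem sign_mul_self (e : Side) : sign e * sign e = 1 := by
  cases e <;> simp [sign]

namespace Cylinder.TransversalField

variable (C) in
/-- The transversal field is `∂ₓ + 2y ∂_y` on the out-boundary and its negative on the in-boundary.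
This direction is orthogonal to `∂M` for the Misner metric (`u = 0`), and it is scaled so that
`∫ μ Γ f = ∮ f dx` over each boundary circle with its boundary orientation. -/
def IsMisnerNormal (n : TransversalField) : Prop :=
  ∀ e, n.toFun e = -sign e • ![1, (2 * (C.bdry e : ℝ)) • 1]

namespace IsMisnerNormal

variable {n : TransversalField}

theorem bdry_ne_zero (hn : n.IsMisnerNormal C) (e : Side) : (C.bdry e : ℝ) ≠ 0 := by
  intro he
  refine n.transversal e 0 ?_
  simp [hn e, he]

theorem flux_eq (hn : n.IsMisnerNormal C) (j : BoundaryJet) (e : Side) :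
    flux (misner C) e (j e) = -sign e • (ofJet n j e).2 := by
  have hn0 : n.toFun e 0 = -sign e • 1 := by rw [hn e]; rfl
  have hn1 : n.toFun e 1 = -sign e • (2 * (C.bdry e : ℝ)) • 1 := by rw [hn e]; rfl
  rw [flux_misner, ofJet_apply, hn0, hn1]
  simp only [one_mul, smul_mul_assoc, ← smul_add, smul_smul _ _ (_ + _), neg_mul_neg,
    sign_mul_self, one_smul]

theorem preOmega_eq (hn : n.IsMisnerNormal C) (v w : PrePhase) :
    preOmega n (misner C) v w = ∑ e, circleInt ((v e).2 * (w e).1 - (v e).1 * (w e).2) := by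
  obtain ⟨j, rfl⟩ := (ofJet n).surjective v
  obtain ⟨k, rfl⟩ := (ofJet n).surjective w
  rw [preOmega_ofJet]
  refine Finset.sum_congr rfl fun e _ => ?_
  rw [hn.flux_eq j, hn.flux_eq k, smul_mul_assoc, smul_mul_assoc, ← smul_sub, map_smul,
    smul_eq_mul, ← mul_assoc, mul_neg, sign_mul_self, neg_one_mul, ← map_neg, neg_sub,
    mul_comm _ ((ofJet n k e).2)]
  rfl

theorem ker_preOmega_eq_bot (hn : n.IsMisnerNormal C) :
    LinearMap.ker (preOmega n (misner C)) = ⊥ := by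
  refine (Submodule.eq_bot_iff _).2 fun v hv => ?_
  obtain ⟨j, rfl⟩ := (ofJet n).surjective v
  have hj : j = 0 := by
    funext e
    obtain ⟨htransport, hval⟩ := (ofJet_mem_ker_preOmega_misner_iff n).1 hv e
    have he := hn.bdry_ne_zero e
    have hval' := (smul_eq_zero_iff_right he).1 hval
    rw [transport_apply, hval', map_zero, zero_add, smul_eq_zero_iff_right he] at htransport
    exact Prod.ext hval' htransport
  rw [hj, map_zero]

theorem toPhase_injective (hn : n.IsMisnerNormal C) :
    Function.Injective (toPhase n (misner C)) := by
  rw [← LinearMap.ker_eq_bot, toPhase, Submodule.ker_mkQ, hn.ker_preOmega_eq_bot]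

theorem toPhase_mem_L_iff (hn : n.IsMisnerNormal C) (h0 : (0 : ℝ) ∈ Set.Icc C.lo C.hi)
    (v : PrePhase) :
    toPhase n (misner C) v ∈ L n (misner C) ↔
      ∃ f, v false = (f, -circleDeriv f) ∧ v true = (f, circleDeriv f) := by
  have hn0 (e : Side) (f : smoothCircle) : n.toFun e 0 * f = -sign e • f := by
    rw [hn e]
    exact smul_one_mul (-sign e) f
  simp only [mem_L_misner_iff n h0, hn.toPhase_injective.eq_iff,
    ofJet_pullbackJet, hn0, funext_iff, Bool.forall_bool, sign, neg_smul, one_smul, neg_neg]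

theorem two_smul_transport (hn : n.IsMisnerNormal C) (j : BoundaryJet) (e : Side) :
    (2 : ℝ) • transport C e (j e) = circleDeriv (ofJet n j e).1 - sign e • (ofJet n j e).2 := by
  rw [sub_eq_add_neg, ← neg_smul, ← hn.flux_eq, flux_misner, transport_apply, smul_add,
    smul_smul, two_smul, add_assoc]
  rfl

theorem toPhase_mem_orth_L_iff (hn : n.IsMisnerNormal C) (h0 : (0 : ℝ) ∈ Set.Icc C.lo C.hi)
    (v : PrePhase) :
    toPhase n (misner C) v ∈ orth n (misner C) (L n (misner C)) ↔
      circleDeriv (v false).1 - (v false).2 - circleDeriv (v true).1 - (v true).2 = 0 := by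
  obtain ⟨j, rfl⟩ := (ofJet n).surjective v
  rw [toPhase_ofJet_mem_orth_L_iff n h0, ← sub_eq_zero,
    ← smul_eq_zero_iff_right (two_ne_zero (α := ℝ)), smul_sub, hn.two_smul_transport,
    hn.two_smul_transport]
  simp only [sign, neg_smul, one_smul]
  exact Eq.congr_left (by abel)

end IsMisnerNormal

end Cylinder.TransversalField

theorem zero_mem_of_misner_cylinder
    (hC : C = fullCylinder ∨ C = lowerHalf ∨ C = upperHalf) : (0 : ℝ) ∈ Set.Icc C.lo C.hi := by
  rcases hC with rfl | rfl | rfl <;> norm_num [fullCylinder, lowerHalf, upperHalf]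

theorem isMisnerNormal_misnerNormal : misnerNormal.IsMisnerNormal fullCylinder := by
  intro e
  cases e <;> simp [misnerNormal, sign, fullCylinder, bdry, Algebra.algebraMap_eq_smul_one]

end WaveCylinder

end

open WaveCylinder Cylinder in
theorem mainTheorem4_general (C : Cylinder) (h0 : (0 : ℝ) ∈ Set.Icc C.lo C.hi) :
    (((misner C).EL : Set C.Fields) = ELglob C ∧
      ((misner C).EL : Set C.Fields) = ELmulti C ∧
      ∀ n : TransversalField,
        (L n (misner C) : Set (Phase n (misner C))) = proj n (misner C) '' ELglob C ∧
        (L n (misner C) : Set (Phase n (misner C))) =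
          {v | ∃ f : smoothCircle,
            v = toPhase n (misner C) fun e => (f, n.toFun e 0 * circleDeriv f)} ∧
        IsIsotropic n (misner C) (L n (misner C)) ∧
        ¬ FiniteDimensional ℝ
          (orth n (misner C) (L n (misner C)) ⧸
            (L n (misner C)).submoduleOf (orth n (misner C) (L n (misner C)))) ∧
        ¬ IsLagrangian n (misner C) (L n (misner C))) ∧
    ∀ n : TransversalField, n.IsMisnerNormal C →
      LinearMap.ker (preOmega n (misner C)) = ⊥ ∧
      (∀ v w : PrePhase, preOmega n (misner C) v w =
        ∑ e, circleInt ((v e).2 * (w e).1 - (v e).1 * (w e).2)) ∧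
      (∀ v : PrePhase, toPhase n (misner C) v ∈ L n (misner C) ↔
        ∃ f : smoothCircle, v false = (f, -circleDeriv f) ∧ v true = (f, circleDeriv f)) ∧
      (∀ v : PrePhase, toPhase n (misner C) v ∈ orth n (misner C) (L n (misner C)) ↔
        circleDeriv (v false).1 - (v false).2 - circleDeriv (v true).1 - (v true).2 = 0) := by
  refine ⟨⟨EL_eq_ELglob h0, EL_eq_ELmulti h0, fun n => ⟨?_, ?_, isIsotropic_L n h0,
    not_finiteDimensional_orth_quotient_L n h0, not_isLagrangian_L n h0⟩⟩, fun n hn =>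
      ⟨hn.ker_preOmega_eq_bot, hn.preOmega_eq, hn.toPhase_mem_L_iff h0,
        hn.toPhase_mem_orth_L_iff h0⟩⟩
  · rw [L, Submodule.map_coe, EL_eq_ELglob h0]
  · ext v
    simp only [SetLike.mem_coe, mem_L_misner_iff n h0, ofJet_pullbackJet, Set.mem_ofPred_eq]

open WaveCylinder Cylinder in
theorem mainTheorem4 :
    (∀ C : Cylinder, C = fullCylinder ∨ C = lowerHalf ∨ C = upperHalf →
      ((misner C).EL : Set C.Fields) = ELglob C ∧
      ((misner C).EL : Set C.Fields) = ELmulti C ∧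
      ∀ n : TransversalField,
        (L n (misner C) : Set (Phase n (misner C))) = proj n (misner C) '' ELglob C ∧
        (L n (misner C) : Set (Phase n (misner C))) =
          {v | ∃ f : smoothCircle,
            v = toPhase n (misner C) fun e => (f, n.toFun e 0 * circleDeriv f)} ∧
        IsIsotropic n (misner C) (L n (misner C)) ∧
        ¬ FiniteDimensional ℝ
          (orth n (misner C) (L n (misner C)) ⧸
            (L n (misner C)).submoduleOf (orth n (misner C) (L n (misner C)))) ∧
        ¬ IsLagrangian n (misner C) (L n (misner C))) ∧
    LinearMap.ker (preOmega misnerNormal (misner fullCylinder)) = ⊥ ∧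
    (∀ v w : PrePhase, preOmega misnerNormal (misner fullCylinder) v w =
      ∑ e, circleInt ((v e).2 * (w e).1 - (v e).1 * (w e).2)) ∧
    (∀ v : PrePhase,
      toPhase misnerNormal (misner fullCylinder) v ∈ L misnerNormal (misner fullCylinder) ↔
        ∃ f : smoothCircle,
          v false = (f, -circleDeriv f) ∧ v true = (f, circleDeriv f)) ∧
    (∀ v : PrePhase,
      toPhase misnerNormal (misner fullCylinder) v ∈
          orth misnerNormal (misner fullCylinder) (L misnerNormal (misner fullCylinder)) ↔
        circleDeriv (v false).1 - (v false).2 - circleDeriv (v true).1 - (v true).2 = 0) := by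
  exact ⟨fun C hC => (mainTheorem4_general C (zero_mem_of_misner_cylinder hC)).1,
    (mainTheorem4_general fullCylinder (zero_mem_of_misner_cylinder (.inl rfl))).2 misnerNormal
      isMisnerNormal_misnerNormal⟩
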